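/- Let $n\ge 0$ be the number of bosonic modes, $\hbar>0$, $\beta>0$, and let $\mathcal H=L^2(\mathbb R^n)$ with the canonical operators $\hat{\mathbf x}=(\hat q_1,\dots,\hat q_n,\hat p_1,\dots,\hat p_n)^{\top}$, $\hat p_j=-i\hbar\,\partial_j$, on the Schwartz space, and $\mathsf J=\begin{pmatrix}0&\mathbb 1\\-\mathbb 1&0\end{pmatrix}$. Let $\hat H_{\rm eff}=\tfrac12\hat{\mathbf x}^{\top}\mathbb B'\hat{\mathbf x}+\hat{\mathbf x}^{\top}\mathsf J\boldsymbol\xi'$ with $\mathbb B'$ a real symmetric $2n\times 2n$ matrix and $\boldsymbol\xi'\in\mathbb R^{2n}$, and let $\hat L_k=\mathbf l_k^{\top}\mathsf J\hat{\mathbf x}$ with $\mathbf l_k\in\mathbb C^{2n}$, $k=1,\dots,K$. Let $\Lambda_t=e^{t\mathcal L}$ ($t\ge 0$) be the Gaussian dynamical semigroup (GDS) in the Schrödinger picture, i.e. the strongly continuous semigroup on the trace-class operators on $\mathcal H$ whose generator $\mathcal L$ is the closure, in the trace norm, of $$\mathcal L[\rho]=-\tfrac{i}{\hbar}[\hat H_{\rm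 eff},\rho]+\tfrac1{2\hbar}\sum_{k=1}^K\bigl(2\hat L_k\rho\hat L_k^\dagger-\hat L_k^\dagger\hat L_k\rho-\rho\hat L_k^\dagger\hat L_k\bigr)$$ on the linear span of the operators $|\varphi\rangle\langle\psi|$ with Schwartz functions $\varphi,\psi$. Let $\bar\Lambda_t$ be the GDS in the Heisenberg picture, i.e. the adjoint of $\Lambda_t$ on the bounded operators with respect to the Hilbert–Schmidt pairing: $\operatorname{Tr}(\Lambda_t[A]^\dagger X)=\operatorname{Tr}(A^\dagger\bar\Lambda_t[X])$ for $A$ of trace class and $X$ bounded. Let $\hat H=\tfrac12\hat{\mathbf x}^{\top}\mathbb B\hat{\mathbf x}$ with $\mathbb B$ a real symmetric matrix such that the unnormalized Gibbs state $\bar\sigma^{\rm th}=e^{-\beta\hat H}$ exists and is of trace class, i.e. has a finite partition function $\operatorname{Tr}\bar\sigma^{\rm th}$ (as is the case for positive definite $\mathbb B$). Suppose that $\bar\Lambda_t$ satisfies the $\bar\sigma^{\rm th}$-detailed-balance condition: for all $t\ge0$ and all bounded operators $X,Y$, $$\operatorname{Tr}\bigl(\bar\sigma^{\rm th}\,\bar\Lambda_t[X]^\dagger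 Y\bigr)=\operatorname{Tr}\bigl(\bar\sigma^{\rm th}X^\dagger\bar\Lambda_t[Y]\bigr).$$ Then $\bar\sigma^{\rm th}$ is invariant under the Schrödinger-picture semigroup: $\Lambda_t[\bar\sigma^{\rm th}]=\bar\sigma^{\rm th}$ for all $t\ge0$, and, equivalently, $\bar\sigma^{\rm th}$ lies in the domain of $\mathcal L$ and $\mathcal L[\bar\sigma^{\rm th}]=0$. -/

import Mathlib

open scoped SchwartzMap InnerProductSpace Topology LineDeriv

noncomputable section

/-! ### Trace-class operators on a complex Hilbert space -/

section TraceClassOperators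

variable {H : Type*} [NormedAddCommGroup H] [InnerProductSpace ℂ H]

/-- `T = ∑ₖ |x k⟩⟨y k|` with `∑ₖ ‖x k‖ ‖y k‖ < ∞`. -/
def IsNuclearRep (x y : ℕ → H) (T : H →L[ℂ] H) : Prop :=
  Summable (fun k => ‖x k‖ * ‖y k‖) ∧ ∀ v : H, HasSum (fun k => ⟪y k, v⟫_ℂ • x k) (T v)

theorem IsNuclearRep.zero : IsNuclearRep (fun _ => (0 : H)) (fun _ => 0) 0 := by
  refine ⟨by simp [summable_zero], fun v => ?_⟩
  simp [hasSum_zero]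

theorem IsNuclearRep.smul {x y : ℕ → H} {T : H →L[ℂ] H} (h : IsNuclearRep x y T) (c : ℂ) :
    IsNuclearRep (fun k => c • x k) y (c • T) := by
  refine ⟨?_, fun v => ?_⟩
  · simpa [norm_smul, mul_assoc] using h.1.mul_left ‖c‖
  · simpa [smul_comm c] using (h.2 v).const_smul c

/-- The concatenation of two sequences. -/
def interleave (x x' : ℕ → H) : ℕ → H :=
  fun k => Sum.elim x x' (Equiv.natSumNatEquivNat.symm k)

theorem IsNuclearRep.hasSum_add {x y x' y' : ℕ → H} {T T' : H →L[ℂ] H}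
    (h : IsNuclearRep x y T) (h' : IsNuclearRep x' y' T') :
    HasSum (fun k => ‖interleave x x' k‖ * ‖interleave y y' k‖)
      ((∑' k, ‖x k‖ * ‖y k‖) + ∑' k, ‖x' k‖ * ‖y' k‖) := by
  rw [← Equiv.natSumNatEquivNat.hasSum_iff]
  refine HasSum.sum ?_ ?_
  · simpa [interleave, Function.comp_def] using h.1.hasSum
  · simpa [interleave, Function.comp_def] using h'.1.hasSum

theorem IsNuclearRep.add {x y x' y' : ℕ → H} {T T' : H →L[ℂ] H}
    (h : IsNuclearRep x y T) (h' : IsNuclearRep x' y' T') :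
    IsNuclearRep (interleave x x') (interleave y y') (T + T') := by
  refine ⟨(h.hasSum_add h').summable, fun v => ?_⟩
  rw [← Equiv.natSumNatEquivNat.hasSum_iff]
  refine HasSum.sum ?_ ?_
  · simpa [interleave, Function.comp_def] using h.2 v
  · simpa [interleave, Function.comp_def] using h'.2 v

theorem IsNuclearRep.opNorm_le {x y : ℕ → H} {T : H →L[ℂ] H} (h : IsNuclearRep x y T) :
    ‖T‖ ≤ ∑' k, ‖x k‖ * ‖y k‖ := by
  refine T.opNorm_le_bound (tsum_nonneg fun k => by positivity) fun v => ?_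
  rw [← (h.2 v).tsum_eq, ← tsum_mul_right]
  refine tsum_of_norm_bounded (h.1.mul_right ‖v‖).hasSum fun k => ?_
  rw [norm_smul]
  calc ‖⟪y k, v⟫_ℂ‖ * ‖x k‖ ≤ (‖y k‖ * ‖v‖) * ‖x k‖ := by
        gcongr; exact norm_inner_le_norm _ _
    _ = ‖x k‖ * ‖y k‖ * ‖v‖ := by ring

variable (H) in
/-- The trace-class (nuclear) operators, as a subspace of the bounded operators. -/
def traceClassSubmodule : Submodule ℂ (H →L[ℂ] H) where
  carrier := {T | ∃ x y : ℕ → H, IsNuclearRep x y T}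
  zero_mem' := ⟨_, _, IsNuclearRep.zero⟩
  add_mem' := by
    rintro _ _ ⟨x, y, h⟩ ⟨x', y', h'⟩
    exact ⟨_, _, h.add h'⟩
  smul_mem' := by
    rintro c _ ⟨x, y, h⟩
    exact ⟨_, _, h.smul c⟩

variable (H) in
/-- The space of trace-class operators; it carries the trace norm (below), not the operator
norm. -/
def TraceClass : Type _ := traceClassSubmodule H

namespace TraceClass

instance : AddCommGroup (TraceClass H) := inferInstanceAs (AddCommGroup (traceClassSubmodule H))

instance : Module ℂ (TraceClass H) := inferInstanceAs (Module ℂ (traceClassSubmodule H))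

/-- The underlying bounded operator. -/
def toOp : TraceClass H →ₗ[ℂ] (H →L[ℂ] H) := (traceClassSubmodule H).subtype

theorem toOp_injective : Function.Injective (toOp : TraceClass H → (H →L[ℂ] H)) :=
  Subtype.val_injective

theorem exists_rep (T : TraceClass H) : ∃ x y : ℕ → H, IsNuclearRep x y (toOp T) := T.2

/-- The trace norm `‖T‖₁`, i.e. the infimum of `∑ₖ ‖x k‖ ‖y k‖` over all the expansions
`T = ∑ₖ |x k⟩⟨y k|`. -/
def traceNorm (T : TraceClass H) : ℝ :=
  sInf {r | ∃ x y : ℕ → H, IsNuclearRep x y (toOp T) ∧ r = ∑' k, ‖x k‖ * ‖y k‖}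

theorem traceNorm_le {T : TraceClass H} {x y : ℕ → H} (h : IsNuclearRep x y (toOp T)) :
    traceNorm T ≤ ∑' k, ‖x k‖ * ‖y k‖ := by
  refine csInf_le ⟨0, ?_⟩ ⟨x, y, h, rfl⟩
  rintro _ ⟨x, y, -, rfl⟩
  exact tsum_nonneg fun k => by positivity

theorem le_traceNorm {T : TraceClass H} {c : ℝ}
    (h : ∀ x y : ℕ → H, IsNuclearRep x y (toOp T) → c ≤ ∑' k, ‖x k‖ * ‖y k‖) :
    c ≤ traceNorm T := by
  obtain ⟨x, y, hxy⟩ := T.exists_rep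
  refine le_csInf ⟨_, x, y, hxy, rfl⟩ ?_
  rintro _ ⟨x, y, hxy, rfl⟩
  exact h x y hxy

theorem opNorm_le_traceNorm (T : TraceClass H) : ‖toOp T‖ ≤ traceNorm T :=
  le_traceNorm fun _ _ h => h.opNorm_le

theorem traceNorm_smul_le (c : ℂ) (T : TraceClass H) :
    traceNorm (c • T) ≤ ‖c‖ * traceNorm T := by
  have key : ∀ x y : ℕ → H, IsNuclearRep x y (toOp T) →
      traceNorm (c • T) ≤ ‖c‖ * ∑' k, ‖x k‖ * ‖y k‖ := fun x y h => by
    have h' : IsNuclearRep (fun k => c • x k) y (toOp (c • T)) := by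
      rw [map_smul]; exact h.smul c
    refine (traceNorm_le h').trans_eq ?_
    rw [← tsum_mul_left]
    simp [norm_smul, mul_assoc]
  rcases eq_or_ne c 0 with rfl | hc
  · obtain ⟨x, y, h⟩ := T.exists_rep
    simpa using key x y h
  · have hc' : 0 < ‖c‖ := norm_pos_iff.2 hc
    rw [← div_le_iff₀' hc']
    exact le_traceNorm fun x y h => (div_le_iff₀' hc').2 (key x y h)

theorem traceNorm_add_le (S T : TraceClass H) :
    traceNorm (S + T) ≤ traceNorm S + traceNorm T := by
  have key : ∀ x y x' y' : ℕ → H, IsNuclearRep x y (toOp S) → IsNuclearRep x' y' (toOp T) →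
      traceNorm (S + T) ≤ (∑' k, ‖x k‖ * ‖y k‖) + ∑' k, ‖x' k‖ * ‖y' k‖ :=
    fun x y x' y' h h' => by
      have h'' : IsNuclearRep (interleave x x') (interleave y y') (toOp (S + T)) := by
        rw [map_add]; exact h.add h'
      exact (traceNorm_le h'').trans_eq (h.hasSum_add h').tsum_eq
  rw [← sub_le_iff_le_add]
  refine le_traceNorm fun x y h => ?_
  rw [sub_le_comm]
  refine le_traceNorm fun x' y' h' => ?_
  rw [sub_le_iff_le_add']
  exact key x y x' y' h h'

instance : NormedAddCommGroup (TraceClass H) :=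
  AddGroupNorm.toNormedAddCommGroup
    { toFun := traceNorm
      map_zero' := le_antisymm (by simpa using traceNorm_smul_le 0 (0 : TraceClass H))
        ((norm_nonneg _).trans (opNorm_le_traceNorm 0))
      add_le' := traceNorm_add_le
      neg' := fun T => by
        have h : ∀ S : TraceClass H, traceNorm (-S) ≤ traceNorm S := fun S => by
          simpa using traceNorm_smul_le (-1) S
        exact le_antisymm (h T) (by simpa using h (-T))
      eq_zero_of_map_eq_zero' := fun T hT => toOp_injective <| by
        rw [map_zero]
        exact norm_le_zero_iff.1 ((opNorm_le_traceNorm T).trans_eq hT) }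

theorem norm_def (T : TraceClass H) : ‖T‖ = traceNorm T := rfl

instance : NormedSpace ℂ (TraceClass H) where
  norm_smul_le := traceNorm_smul_le

/-- The rank-one operator `|φ⟩⟨ψ|`, that is `v ↦ ⟨ψ, v⟩ φ`. -/
def ketBra (φ ψ : H) : TraceClass H :=
  ⟨InnerProductSpace.rankOne ℂ φ ψ, Pi.single 0 φ, Pi.single 0 ψ, by
    constructor
    · exact summable_of_ne_finset_zero (s := {0}) fun k hk => by
        simp [Pi.single_eq_of_ne (Finset.notMem_singleton.1 hk)]
    · intro v
      have := hasSum_single (f := fun k : ℕ =>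
        ⟪(Pi.single 0 ψ : ℕ → H) k, v⟫_ℂ • (Pi.single 0 φ : ℕ → H) k) 0
        (fun k hk => by simp [Pi.single_eq_of_ne hk])
      simpa using this⟩

theorem ketBra_apply (φ ψ v : H) : toOp (ketBra φ ψ) v = ⟪ψ, v⟫_ℂ • φ := by
  change InnerProductSpace.rankOne ℂ φ ψ v = _
  simp

end TraceClass

variable [CompleteSpace H]

/-- The trace `∑ᵢ ⟨bᵢ, T bᵢ⟩` of an operator, over an orthonormal basis `b` of `H`. For
trace-class `T` the series converges absolutely and its sum does not depend on `b`. -/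
def opTrace (T : H →L[ℂ] H) : ℂ :=
  ∑' i, ⟪(exists_hilbertBasis ℂ H).choose_spec.choose i,
    T ((exists_hilbertBasis ℂ H).choose_spec.choose i)⟫_ℂ

/-- The Hilbert-Schmidt pairing `⟨A, B⟩ = Tr(A† B)`. -/
def hsInner (A B : H →L[ℂ] H) : ℂ := opTrace (star A * B)

/-- The `ρ`-GNS inner product `Tr(ρ A† B)` on the bounded operators. -/
def gnsInner (ρ : TraceClass H) (A B : H →L[ℂ] H) : ℂ := opTrace (ρ.toOp * (star A * B))

end TraceClassOperators

/-! ### One-parameter semigroups and their generators -/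

section Semigroups

variable {E : Type*} [NormedAddCommGroup E] [NormedSpace ℂ E]

/-- The value of the (one-sided) generator of `S` at `u` is `v`:
`lim_{t → 0+} (S t u - u) / t = v` in norm. -/
def HasGenerator (S : ℝ → E →L[ℂ] E) (u v : E) : Prop :=
  Filter.Tendsto (fun t : ℝ => ((t : ℂ)⁻¹) • (S t u - u)) (𝓝[>] 0) (𝓝 v)

/-- `S t = e^{tG}` for `t ≥ 0`, where `G` is given by its graph: `(S t)_{t ≥ 0}` is a strongly
continuous one-parameter semigroup of bounded operators and its generator is the closure of `G`.
Only the values `S t` with `t ≥ 0` matter; they are determined by `G`. -/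
structure IsExpSemigroup (G : Submodule ℂ (E × E)) (S : ℝ → E →L[ℂ] E) : Prop where
  map_zero : S 0 = ContinuousLinearMap.id ℂ E
  map_add : ∀ s t : ℝ, 0 ≤ s → 0 ≤ t → S (s + t) = S s ∘L S t
  continuousOn : ∀ u : E, ContinuousOn (fun t => S t u) (Set.Ici 0)
  generator : ∀ u v : E, HasGenerator S u v ↔ (u, v) ∈ G.topologicalClosure

end Semigroups

/-! ### The system of `n` bosonic modes -/

section Modes

/-- The Hilbert space `L²(ℝⁿ)` of `n` bosonic modes. -/
abbrev ModeSpace (n : ℕ) : Type :=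
  MeasureTheory.Lp ℂ 2 (MeasureTheory.volume : MeasureTheory.Measure (EuclideanSpace ℝ (Fin n)))

/-- The Schwartz space, the common domain of all the polynomials in the canonical operators. -/
abbrev ModeSchwartz (n : ℕ) : Type := 𝓢(EuclideanSpace ℝ (Fin n), ℂ)

variable {n : ℕ}

/-- The vector of `L²(ℝⁿ)` given by a Schwartz function. -/
def ket (φ : ModeSchwartz n) : ModeSpace n :=
  SchwartzMap.toLpCLM ℂ ℂ 2 MeasureTheory.volume φ

/-- The position operator `q_j`: multiplication by the `j`-th coordinate. -/
def positionOp (j : Fin n) : ModeSchwartz n →ₗ[ℂ] ModeSchwartz n :=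
  (SchwartzMap.smulLeftCLM ℂ
    (fun x : EuclideanSpace ℝ (Fin n) => ((x j : ℝ) : ℂ))).toLinearMap

theorem positionOp_apply (j : Fin n) (φ : ModeSchwartz n) (x : EuclideanSpace ℝ (Fin n)) :
    positionOp j φ x = ((x j : ℝ) : ℂ) * φ x := by
  have h : Function.HasTemperateGrowth
      (fun x : EuclideanSpace ℝ (Fin n) => ((x j : ℝ) : ℂ)) :=
    (Complex.ofRealCLM ∘L (EuclideanSpace.proj j : EuclideanSpace ℝ (Fin n) →L[ℝ] ℝ)).hasTemperateGrowth
  simp [positionOp, SchwartzMap.smulLeftCLM_apply_apply h]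

/-- The momentum operator `p_j = -iħ ∂_j`. -/
def momentumOp (ħ : ℝ) (j : Fin n) : ModeSchwartz n →ₗ[ℂ] ModeSchwartz n :=
  (-(Complex.I * (ħ : ℂ))) •
    (LineDeriv.lineDerivOpCLM ℂ (ModeSchwartz n)
      (EuclideanSpace.single j (1 : ℝ))).toLinearMap

/-- The vector `x̂ = (q_1, …, q_n, p_1, …, p_n)` of canonical operators; the index set
`Fin n ⊕ Fin n` lists the positions first and the momenta second. -/
def canonicalOp (ħ : ℝ) : Fin n ⊕ Fin n → (ModeSchwartz n →ₗ[ℂ] ModeSchwartz n) :=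
  Sum.elim positionOp (momentumOp ħ)

/-- The symplectic matrix `J = ((0, 1), (-1, 0))`, so that `[x̂_j, x̂_k] = iħ J_jk`. -/
def sympJ (n : ℕ) (R : Type*) [Ring R] : Matrix (Fin n ⊕ Fin n) (Fin n ⊕ Fin n) R :=
  Matrix.fromBlocks 0 1 (-1) 0

/-- The Hamiltonian `½ x̂ᵀ B x̂ + x̂ᵀ J ξ`. -/
def quadHamiltonian (ħ : ℝ) (B : Matrix (Fin n ⊕ Fin n) (Fin n ⊕ Fin n) ℝ)
    (ξ : Fin n ⊕ Fin n → ℝ) : ModeSchwartz n →ₗ[ℂ] ModeSchwartz n :=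
  (1 / 2 : ℂ) • (∑ j, ∑ k, (B j k : ℂ) • (canonicalOp ħ j ∘ₗ canonicalOp ħ k)) +
    ∑ j, ((sympJ n ℝ).mulVec ξ j : ℂ) • canonicalOp ħ j

/-- The Lindblad operator `L = lᵀ J x̂`. -/
def lindbladOp (ħ : ℝ) (l : Fin n ⊕ Fin n → ℂ) : ModeSchwartz n →ₗ[ℂ] ModeSchwartz n :=
  ∑ j, (Matrix.vecMul l (sympJ n ℂ) j) • canonicalOp ħ j

/-- The adjoint Lindblad operator `L† = l^† J x̂`. -/
def lindbladOpAdj (ħ : ℝ) (l : Fin n ⊕ Fin n → ℂ) : ModeSchwartz n →ₗ[ℂ] ModeSchwartz n :=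
  lindbladOp ħ (star l)

/-- The Schrödinger-picture Lindblad expression
`𝓛[ρ] = -(i/ħ) [H, ρ] + (1/2ħ) ∑ₖ (2 Lₖ ρ Lₖ† - Lₖ† Lₖ ρ - ρ Lₖ† Lₖ)` evaluated at
`ρ = |φ⟩⟨ψ|` with Schwartz functions `φ`, `ψ`, for a symmetric operator `Ham` on the Schwartz
space, for `L k = Lₖ` and for `L' k = Lₖ†`. -/
def lindbladKetBra {K : ℕ} (ħ : ℝ) (Ham : ModeSchwartz n →ₗ[ℂ] ModeSchwartz n)
    (L L' : Fin K → (ModeSchwartz n →ₗ[ℂ] ModeSchwartz n)) (φ ψ : ModeSchwartz n) :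
    TraceClass (ModeSpace n) :=
  (-(Complex.I / (ħ : ℂ))) •
      (TraceClass.ketBra (ket (Ham φ)) (ket ψ) - TraceClass.ketBra (ket φ) (ket (Ham ψ))) +
    (1 / (2 * (ħ : ℂ))) • ∑ k,
      ((2 : ℂ) • TraceClass.ketBra (ket (L k φ)) (ket (L k ψ)) -
        TraceClass.ketBra (ket (L' k (L k φ))) (ket ψ) -
        TraceClass.ketBra (ket φ) (ket (L' k (L k ψ))))

/-- The graph of the Lindblad expression of a Gaussian dynamical semigroup on the linear span of
the operators `|φ⟩⟨ψ|` with Schwartz functions `φ`, `ψ`. -/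
def gaussianLindbladGraph {K : ℕ} (ħ : ℝ) (B' : Matrix (Fin n ⊕ Fin n) (Fin n ⊕ Fin n) ℝ)
    (ξ' : Fin n ⊕ Fin n → ℝ) (l : Fin K → Fin n ⊕ Fin n → ℂ) :
    Submodule ℂ (TraceClass (ModeSpace n) × TraceClass (ModeSpace n)) :=
  Submodule.span ℂ (Set.range fun p : ModeSchwartz n × ModeSchwartz n =>
    (TraceClass.ketBra (ket p.1) (ket p.2),
      lindbladKetBra ħ (quadHamiltonian ħ B' ξ') (fun k => lindbladOp ħ (l k))
        (fun k => lindbladOpAdj ħ (l k)) p.1 p.2))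

/-- `Λ t = e^{t𝓛}` (`t ≥ 0`) is the Gaussian dynamical semigroup in the Schrödinger picture with
Hamiltonian `½ x̂ᵀ B' x̂ + x̂ᵀ J ξ'` and Lindblad operators `(l k)ᵀ J x̂`. -/
def IsGDS {K : ℕ} (ħ : ℝ) (B' : Matrix (Fin n ⊕ Fin n) (Fin n ⊕ Fin n) ℝ)
    (ξ' : Fin n ⊕ Fin n → ℝ) (l : Fin K → Fin n ⊕ Fin n → ℂ)
    (Λ : ℝ → TraceClass (ModeSpace n) →L[ℂ] TraceClass (ModeSpace n)) : Prop :=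
  IsExpSemigroup (gaussianLindbladGraph ħ B' ξ' l) Λ

/-- `Λbar` is the Heisenberg picture of `Λ`: the adjoint with respect to the Hilbert-Schmidt
pairing, `⟨Λ_t[A], X⟩ = ⟨A, Λbar_t[X]⟩` for `A` of trace class and `X` bounded. -/
def IsHeisenbergPicture
    (Λ : ℝ → TraceClass (ModeSpace n) →L[ℂ] TraceClass (ModeSpace n))
    (Λbar : ℝ → (ModeSpace n →L[ℂ] ModeSpace n) →L[ℂ] (ModeSpace n →L[ℂ] ModeSpace n)) : Prop :=
  ∀ t : ℝ, 0 ≤ t → ∀ (A : TraceClass (ModeSpace n)) (X : ModeSpace n →L[ℂ] ModeSpace n),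
    hsInner (Λ t A).toOp X = hsInner A.toOp (Λbar t X)

/-- The graph of `-Ham` on the Schwartz space. -/
def negGraph (Ham : ModeSchwartz n →ₗ[ℂ] ModeSchwartz n) :
    Submodule ℂ (ModeSpace n × ModeSpace n) :=
  Submodule.span ℂ (Set.range fun φ : ModeSchwartz n => (ket φ, -ket (Ham φ)))

/-- `σ` is the unnormalized Gibbs state `e^{-βH}` of `H = ½ x̂ᵀ B x̂`, with finite partition
function `Tr e^{-βH}` (it is an element of the trace class). The operators `e^{-sH}`, `s ≥ 0`,
are the semigroup generated by the closure of `-H`. -/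
def IsGibbs (ħ β : ℝ) (B : Matrix (Fin n ⊕ Fin n) (Fin n ⊕ Fin n) ℝ)
    (σ : TraceClass (ModeSpace n)) : Prop :=
  ∃ S : ℝ → ModeSpace n →L[ℂ] ModeSpace n,
    IsExpSemigroup (negGraph (quadHamiltonian ħ B 0)) S ∧ σ.toOp = S β

/-- The `σ`-detailed-balance condition: every `Λbar t`, `t ≥ 0`, is self-adjoint with respect to
the `σ`-GNS inner product. -/
def DetailedBalance (σ : TraceClass (ModeSpace n))
    (Λbar : ℝ → (ModeSpace n →L[ℂ] ModeSpace n) →L[ℂ] (ModeSpace n →L[ℂ] ModeSpace n)) : Prop :=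
  ∀ t : ℝ, 0 ≤ t → ∀ X Y : ModeSpace n →L[ℂ] ModeSpace n,
    gnsInner σ (Λbar t X) Y = gnsInner σ X (Λbar t Y)

end Modes

end

/-! Putting `X = 1` in detailed balance and using `Λbar t 1 = 1` gives `Tr(σ Y) = Tr(σ Λbar_t[Y])`.
Since `σ` is self-adjoint, the right side is the Hilbert–Schmidt pairing of `σ` with `Λbar_t[Y]`,
that is `Tr(Λ_t[σ]† Y)`. Rank-one `Y` then force `Λ_t[σ]† = σ†`.

Unitality (`IsGDS.heisenbergPicture_one`) is dual to trace preservation: the trace is continuous for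
the trace norm and kills the Lindblad expression on Schwartz rank-one operators, hence the closed
generator, so it is constant along orbits (`IsExpSemigroup.functional_apply_eq`).

Self-adjointness of `σ` (`IsGibbs.star_eq_self`) holds because a semigroup generated by the closure
of a densely defined symmetric operator is self-adjoint: `⟨S_s u, S_{t-s} v⟩` does not depend on
`s`. -/

/-! ### The trace on nuclear operators -/

section Trace

variable {H : Type*} [NormedAddCommGroup H] [InnerProductSpace ℂ H]

/-- Cauchy–Schwarz combined with Bessel for `x` and for `y`; the bound is uniform in `s`, hence
gives absolute summability. -/
theorem Orthonormal.sum_norm_inner_mul_norm_inner_le {ι : Type*} {b : ι → H}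
    (hb : Orthonormal ℂ b) (x y : H) (s : Finset ι) :
    ∑ i ∈ s, ‖⟪y, b i⟫_ℂ * ⟪b i, x⟫_ℂ‖ ≤ ‖x‖ * ‖y‖ := by
  have hx : ∑ i ∈ s, ‖⟪b i, x⟫_ℂ‖ ^ 2 ≤ ‖x‖ ^ 2 := hb.sum_inner_products_le x
  have hy : ∑ i ∈ s, ‖⟪y, b i⟫_ℂ‖ ^ 2 ≤ ‖y‖ ^ 2 := by
    simpa only [norm_inner_symm] using hb.sum_inner_products_le y (s := s)
  simp only [norm_mul]
  refine abs_le_of_sq_le_sq' ?_ (by positivity) |>.2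
  refine (Finset.sum_mul_sq_le_sq_mul_sq s _ _).trans ?_
  rw [mul_pow, mul_comm (‖x‖ ^ 2)]
  gcongr

variable {ι : Type*}

theorem IsNuclearRep.summable_prod {x y : ℕ → H} {T : H →L[ℂ] H} (h : IsNuclearRep x y T)
    (b : HilbertBasis ι ℂ H) :
    Summable fun p : ℕ × ι => ⟪y p.1, b p.2⟫_ℂ * ⟪b p.2, x p.1⟫_ℂ := by
  refine Summable.of_norm ?_
  rw [summable_prod_of_nonneg fun _ => norm_nonneg _]
  have hs := fun k => b.orthonormal.sum_norm_inner_mul_norm_inner_le (x k) (y k)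
  refine ⟨fun k => summable_of_sum_le (fun _ => norm_nonneg _) (hs k), ?_⟩
  exact h.1.of_nonneg_of_le (fun k => tsum_nonneg fun _ => norm_nonneg _)
    fun k => Real.tsum_le_of_sum_le (fun _ => norm_nonneg _) (hs k)

theorem IsNuclearRep.mul_left {x y : ℕ → H} {T : H →L[ℂ] H} (h : IsNuclearRep x y T)
    (Y : H →L[ℂ] H) : IsNuclearRep (fun k => Y (x k)) y (Y * T) := by
  refine ⟨(h.1.mul_left ‖Y‖).of_nonneg_of_le (fun k => by positivity) fun k => ?_,
    fun v => ?_⟩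
  · rw [← mul_assoc]
    gcongr
    exact Y.le_opNorm _
  · simpa [Function.comp_def] using Y.hasSum (h.2 v)

theorem isNuclearRep_rankOne (φ ψ : H) :
    IsNuclearRep (Pi.single 0 φ) (Pi.single 0 ψ) (InnerProductSpace.rankOne ℂ φ ψ) := by
  constructor
  · exact summable_of_ne_finset_zero (s := {0}) fun k hk => by
      simp [Pi.single_eq_of_ne (Finset.notMem_singleton.1 hk)]
  · intro v
    have := hasSum_single (f := fun k : ℕ =>
      ⟪(Pi.single 0 ψ : ℕ → H) k, v⟫_ℂ • (Pi.single 0 φ : ℕ → H) k) 0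
      (fun k hk => by simp [Pi.single_eq_of_ne hk])
    simpa using this

namespace TraceClass

theorem toOp_ketBra (φ ψ : H) : toOp (ketBra φ ψ) = InnerProductSpace.rankOne ℂ φ ψ := rfl

theorem norm_ketBra_le (φ ψ : H) : ‖ketBra φ ψ‖ ≤ ‖φ‖ * ‖ψ‖ := by
  refine (traceNorm_le (isNuclearRep_rankOne φ ψ)).trans_eq ?_
  rw [tsum_eq_single 0 fun k hk => by simp [Pi.single_eq_of_ne hk]]
  simp

variable (H) in
/-- The map `(φ, ψ) ↦ |φ⟩⟨ψ|` as a continuous sesquilinear map into the trace class. -/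
noncomputable def ketBraCLM : H →L[ℂ] H →L⋆[ℂ] TraceClass H :=
  LinearMap.mkContinuous₂
    (LinearMap.mk₂'ₛₗ (RingHom.id ℂ) (starRingEnd ℂ) ketBra
      (fun φ φ' ψ => toOp_injective <| by simp [toOp_ketBra])
      (fun c φ ψ => toOp_injective <| by simp [toOp_ketBra])
      (fun φ ψ ψ' => toOp_injective <| by simp [toOp_ketBra])
      (fun c φ ψ => toOp_injective <| by simp [toOp_ketBra]))
    1 fun φ ψ => by simpa using norm_ketBra_le φ ψ

theorem continuous_ketBra_left (ψ : H) : Continuous fun φ => ketBra φ ψ :=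
  ((ketBraCLM H).flip ψ).continuous

theorem continuous_ketBra_right (φ : H) : Continuous fun ψ => ketBra φ ψ :=
  (ketBraCLM H φ).continuous

end TraceClass

/-- Absolute convergence allows the double series to be summed in either order; Parseval evaluates
the sum over the basis. The value does not involve `b`, so the basis chosen in `opTrace` is
immaterial. -/
theorem IsNuclearRep.hasSum_inner_apply {x y : ℕ → H} {T : H →L[ℂ] H} (h : IsNuclearRep x y T)
    (b : HilbertBasis ι ℂ H) :
    HasSum (fun i => ⟪b i, T (b i)⟫_ℂ) (∑' k, ⟪y k, x k⟫_ℂ) := by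
  have hp := h.summable_prod b
  have h1 := hp.hasSum.prod_fiberwise fun k => b.hasSum_inner_mul_inner (y k) (x k)
  rw [h1.tsum_eq]
  refine ((Equiv.prodComm ι ℕ).hasSum_iff.2 hp.hasSum).prod_fiberwise fun i => ?_
  have := (innerSL ℂ (b i)).hasSum (h.2 (b i))
  simpa [Function.comp_def, inner_smul_right] using this

variable [CompleteSpace H]

theorem IsNuclearRep.opTrace_eq {x y : ℕ → H} {T : H →L[ℂ] H} (h : IsNuclearRep x y T) :
    opTrace T = ∑' k, ⟪y k, x k⟫_ℂ :=
  (h.hasSum_inner_apply _).tsum_eq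

theorem IsNuclearRep.norm_opTrace_le {x y : ℕ → H} {T : H →L[ℂ] H} (h : IsNuclearRep x y T) :
    ‖opTrace T‖ ≤ ∑' k, ‖x k‖ * ‖y k‖ := by
  rw [h.opTrace_eq]
  refine tsum_of_norm_bounded h.1.hasSum fun k => ?_
  rw [mul_comm]
  exact norm_inner_le_norm _ _

theorem IsNuclearRep.mul_right {x y : ℕ → H} {T : H →L[ℂ] H} (h : IsNuclearRep x y T)
    (Y : H →L[ℂ] H) : IsNuclearRep x (fun k => star Y (y k)) (T * Y) := by
  refine ⟨(h.1.mul_right ‖star Y‖).of_nonneg_of_le (fun k => by positivity) fun k => ?_,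
    fun v => ?_⟩
  · rw [mul_assoc]
    gcongr
    rw [mul_comm]
    exact (star Y).le_opNorm _
  · simpa [ContinuousLinearMap.star_eq_adjoint, ContinuousLinearMap.adjoint_inner_left]
      using h.2 (Y v)

theorem IsNuclearRep.opTrace_mul_comm {x y : ℕ → H} {T : H →L[ℂ] H} (h : IsNuclearRep x y T)
    (Y : H →L[ℂ] H) : opTrace (T * Y) = opTrace (Y * T) := by
  rw [(h.mul_right Y).opTrace_eq, (h.mul_left Y).opTrace_eq]
  simp [ContinuousLinearMap.star_eq_adjoint, ContinuousLinearMap.adjoint_inner_left]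

/-- No trace-class assumption is needed: `tsum_star` also covers divergent series, where both sides
are `0`. -/
theorem opTrace_star (T : H →L[ℂ] H) : opTrace (star T) = star (opTrace T) := by
  rw [opTrace, opTrace, tsum_star]
  simp [ContinuousLinearMap.star_eq_adjoint, ContinuousLinearMap.adjoint_inner_right]

theorem opTrace_mul_rankOne (T : H →L[ℂ] H) (φ ψ : H) :
    opTrace (T * InnerProductSpace.rankOne ℂ φ ψ) = ⟪ψ, T φ⟫_ℂ := by
  rw [((isNuclearRep_rankOne φ ψ).mul_left T).opTrace_eq, tsum_eq_single 0 fun k hk => by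
    simp [Pi.single_eq_of_ne hk]]
  simp

theorem opTrace_rankOne (φ ψ : H) : opTrace (InnerProductSpace.rankOne ℂ φ ψ) = ⟪ψ, φ⟫_ℂ := by
  simpa using opTrace_mul_rankOne 1 φ ψ

/-- Operators with the same trace against all the rank-one operators agree. -/
theorem eq_of_opTrace_mul_rankOne {S T : H →L[ℂ] H}
    (h : ∀ φ ψ : H, opTrace (S * InnerProductSpace.rankOne ℂ φ ψ) =
      opTrace (T * InnerProductSpace.rankOne ℂ φ ψ)) : S = T := by
  ext φ
  refine ext_inner_left ℂ fun ψ => ?_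
  simpa only [opTrace_mul_rankOne] using h φ ψ

namespace TraceClass

variable (H) in
/-- The trace, as a continuous functional for the trace norm. -/
noncomputable def traceCLM : TraceClass H →L[ℂ] ℂ :=
  LinearMap.mkContinuous
    { toFun := fun T => opTrace T.toOp
      map_add' := fun S T => by
        obtain ⟨_, _, hS⟩ := S.exists_rep
        obtain ⟨_, _, hT⟩ := T.exists_rep
        rw [opTrace, map_add]
        simp only [add_apply, inner_add_right]
        exact (hS.hasSum_inner_apply _).summable.tsum_add (hT.hasSum_inner_apply _).summable
      map_smul' := fun c T => by
        rw [opTrace, map_smul]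
        simp only [smul_apply, inner_smul_right, tsum_mul_left]
        rfl }
    1 fun T => by
      rw [one_mul]
      exact le_traceNorm fun x y h => h.norm_opTrace_le

theorem traceCLM_apply (T : TraceClass H) : traceCLM H T = opTrace T.toOp := rfl

theorem traceCLM_ketBra (φ ψ : H) : traceCLM H (ketBra φ ψ) = ⟪ψ, φ⟫_ℂ :=
  opTrace_rankOne φ ψ

end TraceClass

end Trace

/-! ### Orbits of one-parameter semigroups -/

section GeneratorCalculus

variable {E : Type*} [NormedAddCommGroup E] [NormedSpace ℂ E]

namespace IsExpSemigroup

variable {G : Submodule ℂ (E × E)} {S : ℝ → E →L[ℂ] E}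

theorem hasGenerator_apply (hS : IsExpSemigroup G S) {u v : E} (h : HasGenerator S u v)
    {s : ℝ} (hs : 0 ≤ s) : HasGenerator S (S s u) (S s v) := by
  refine (((S s).continuous.tendsto v).comp h).congr' ?_
  filter_upwards [self_mem_nhdsWithin] with t ht
  have h1 := congrArg (· u) (hS.map_add s t hs (le_of_lt ht))
  have h2 := congrArg (· u) (hS.map_add t s (le_of_lt ht) hs)
  simp only [ContinuousLinearMap.comp_apply] at h1 h2
  simp [← h1, ← h2, add_comm]

/-- The semigroup law turns the slope at `s` into the difference quotient at `0` of `S s u`. Only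
the right derivative comes out directly. -/
theorem hasDerivWithinAt (hS : IsExpSemigroup G S) {u v : E} (h : HasGenerator S u v)
    {s : ℝ} (hs : 0 ≤ s) : HasDerivWithinAt (fun t => S t u) (S s v) (Set.Ici s) s := by
  rw [← hasDerivWithinAt_Ioi_iff_Ici, hasDerivWithinAt_iff_tendsto_slope' (by simp)]
  have hsub : Filter.Tendsto (fun y : ℝ => y - s) (𝓝[>] s) (𝓝[>] 0) := by
    refine tendsto_nhdsWithin_iff.2 ⟨?_, ?_⟩
    · exact ((continuous_id.sub continuous_const).tendsto' s 0 (by simp)).mono_left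
        nhdsWithin_le_nhds
    · filter_upwards [self_mem_nhdsWithin] with y hy
      exact sub_pos.2 (Set.mem_Ioi.1 hy)
  refine ((hS.hasGenerator_apply h hs).comp hsub).congr' ?_
  filter_upwards [self_mem_nhdsWithin] with y hy
  have h1 := congrArg (· u) (hS.map_add (y - s) s (sub_nonneg.2 (le_of_lt hy)) hs)
  simp only [ContinuousLinearMap.comp_apply, sub_add_cancel] at h1
  rw [Function.comp_apply, slope_def_module, h1, ← Complex.ofReal_inv, Complex.coe_smul]

theorem mem_topologicalClosure_apply (hS : IsExpSemigroup G S) {u v : E}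
    (h : (u, v) ∈ G.topologicalClosure) {s : ℝ} (hs : 0 ≤ s) :
    (S s u, S s v) ∈ G.topologicalClosure :=
  (hS.generator _ _).1 (hS.hasGenerator_apply ((hS.generator _ _).2 h) hs)

/-- A functional that annihilates the range of the generator is conserved on its domain. -/
theorem functional_apply_eq (hS : IsExpSemigroup G S) (F : E →L[ℂ] ℂ)
    (hF : ∀ p ∈ G, F p.2 = 0) {u v : E} (h : (u, v) ∈ G) {t : ℝ} (ht : 0 ≤ t) :
    F (S t u) = F u := by
  have hcl : ∀ p ∈ G.topologicalClosure, F p.2 = 0 := fun p hp =>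
    closure_minimal (t := {p : E × E | F p.2 = 0}) hF
      (isClosed_eq (F.continuous.comp continuous_snd) continuous_const) hp
  have huv := G.le_topologicalClosure h
  have hcont : ContinuousOn (fun s => F (S s u)) (Set.Icc 0 t) :=
    F.continuous.comp_continuousOn ((hS.continuousOn u).mono Set.Icc_subset_Ici_self)
  -- The pair `(S s u, S s v)` stays in the closed graph, so the right derivative `F (S s v)`
  -- vanishes.
  have key := constant_of_has_deriv_right_zero hcont (fun s hs => by
    have h1 := ((F.restrictScalars ℝ).hasFDerivAt.comp_hasDerivWithinAt s
      (hS.hasDerivWithinAt ((hS.generator _ _).2 huv) hs.1))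
    have h2 := hcl _ (hS.mem_topologicalClosure_apply huv hs.1)
    simpa [Function.comp_def, h2] using h1) t (Set.right_mem_Icc.2 ht)
  simpa [hS.map_zero] using key

/-- On the domain of the generator, the orbits of the semigroup are differentiable. -/
theorem hasDerivAt [CompleteSpace E] (hS : IsExpSemigroup G S) {u v : E}
    (h : HasGenerator S u v) {s : ℝ} (hs : 0 < s) :
    HasDerivAt (fun t => S t u) (S s v) s := by
  -- Truncating at `0` makes the integrand continuous on all of `ℝ`, so its primitive is
  -- differentiable from both sides. The orbit equals `u` plus this primitive, because their
  -- difference has zero right derivative.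
  have hg : Continuous fun r : ℝ => S (max r 0) v :=
    (hS.continuousOn v).comp_continuous (by fun_prop) fun r => le_max_right r 0
  have hI : ∀ r : ℝ, HasDerivAt (fun t => ∫ x in (0 : ℝ)..t, S (max x 0) v) (S (max r 0) v) r :=
    fun r => hg.integral_hasStrictDerivAt 0 r |>.hasDerivAt
  have key : ∀ t : ℝ, 0 ≤ t → S t u - ∫ x in (0 : ℝ)..t, S (max x 0) v = u := fun t ht => by
    have := constant_of_has_deriv_right_zero
      (f := fun t => S t u - ∫ x in (0 : ℝ)..t, S (max x 0) v) (a := 0) (b := t)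
      (((hS.continuousOn u).mono Set.Icc_subset_Ici_self).sub
        fun r _ => (hI r).continuousAt.continuousWithinAt)
      (fun r hr => by
        have h1 := (hS.hasDerivWithinAt h hr.1).sub (hI r).hasDerivWithinAt (s := Set.Ici r)
        rwa [max_eq_left hr.1, sub_self] at h1) t (Set.right_mem_Icc.2 ht)
    simpa [hS.map_zero] using this
  have h1 : HasDerivAt (fun t => u + ∫ x in (0 : ℝ)..t, S (max x 0) v) (S s v) s := by
    simpa [max_eq_left hs.le] using (hI s).const_add u
  refine h1.congr_of_eventuallyEq ?_
  filter_upwards [lt_mem_nhds hs] with t ht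
  rw [← sub_eq_iff_eq_add, key t ht.le]

end IsExpSemigroup

variable {H : Type*} [NormedAddCommGroup H] [InnerProductSpace ℂ H] [CompleteSpace H]

/-- A semigroup generated by the closure of a densely defined symmetric operator is
self-adjoint. -/
theorem IsExpSemigroup.star_eq_self {G : Submodule ℂ (H × H)} {S : ℝ → H →L[ℂ] H}
    (hS : IsExpSemigroup G S) (hG : ∀ p ∈ G, ∀ q ∈ G, ⟪p.2, q.1⟫_ℂ = ⟪p.1, q.2⟫_ℂ)
    (hd : Dense {u : H | ∃ v, (u, v) ∈ G}) {t : ℝ} (ht : 0 ≤ t) : star (S t) = S t := by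
  have hG1 : ∀ p ∈ G.topologicalClosure, ∀ q ∈ G, ⟪p.2, q.1⟫_ℂ = ⟪p.1, q.2⟫_ℂ :=
    fun p hp q hq => closure_minimal (t := {p : H × H | ⟪p.2, q.1⟫_ℂ = ⟪p.1, q.2⟫_ℂ})
      (fun p hp => hG p hp q hq) (isClosed_eq (by fun_prop) (by fun_prop)) hp
  have hG2 : ∀ p ∈ G.topologicalClosure, ∀ q ∈ G.topologicalClosure,
      ⟪p.2, q.1⟫_ℂ = ⟪p.1, q.2⟫_ℂ :=
    fun p hp q hq => closure_minimal (t := {q : H × H | ⟪p.2, q.1⟫_ℂ = ⟪p.1, q.2⟫_ℂ})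
      (fun q hq => hG1 p hp q hq) (isClosed_eq (by fun_prop) (by fun_prop)) hq
  have key : ∀ u v : H, (∃ u', (u, u') ∈ G) → (∃ v', (v, v') ∈ G) →
      ⟪S t u, v⟫_ℂ = ⟪u, S t v⟫_ℂ := by
    rintro u v ⟨u', hu⟩ ⟨v', hv⟩
    have hu' := G.le_topologicalClosure hu
    have hv' := G.le_topologicalClosure hv
    have hcont : ContinuousOn (fun s => ⟪S s u, S (t - s) v⟫_ℂ) (Set.Icc 0 t) :=
      ((hS.continuousOn u).mono Set.Icc_subset_Ici_self).inner
        ((hS.continuousOn v).comp (by fun_prop) fun s hs => sub_nonneg.2 hs.2)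
    have h0 := constant_of_has_deriv_right_zero hcont (fun s hs => by
      have h1 := hS.hasDerivWithinAt ((hS.generator _ _).2 hu') hs.1
      -- The reflection `s ↦ t - s` exchanges left and right, so the two-sided derivative of the
      -- orbit is required; it is available as `t - s > 0`.
      have h2 := ((hS.hasDerivAt ((hS.generator _ _).2 hv')
        (sub_pos.2 hs.2)).scomp s ((hasDerivAt_id s).const_sub t)).hasDerivWithinAt (s := Set.Ici s)
      have h3 := hG2 _ (hS.mem_topologicalClosure_apply hu' hs.1) _
        (hS.mem_topologicalClosure_apply hv' (sub_nonneg.2 hs.2.le))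
      have h4 := h1.inner ℂ h2
      simpa [Function.comp_def, h3] using h4) t (Set.right_mem_Icc.2 ht)
    simpa [hS.map_zero] using h0
  ext v
  refine ext_inner_left ℂ fun u => ?_
  rw [ContinuousLinearMap.star_eq_adjoint, ContinuousLinearMap.adjoint_inner_right]
  revert u v
  have hsub : ∀ u v : H, (∃ u', (u, u') ∈ G) → ⟪S t u, v⟫_ℂ = ⟪u, S t v⟫_ℂ := fun u v hu =>
    hd.induction (P := fun v => ⟪S t u, v⟫_ℂ = ⟪u, S t v⟫_ℂ) (fun v hv => key u v hu hv)
      (isClosed_eq (by fun_prop) (by fun_prop)) v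
  intro v u
  exact hd.induction (P := fun u => ⟪S t u, v⟫_ℂ = ⟪u, S t v⟫_ℂ) (fun u hu => hsub u v hu)
      (isClosed_eq (by fun_prop) (by fun_prop)) u

end GeneratorCalculus

/-! ### Symmetry of the canonical operators, trace preservation, Gibbs states -/

section Modes

variable {n : ℕ}

theorem denseRange_ket : DenseRange (ket : ModeSchwartz n → ModeSpace n) :=
  SchwartzMap.denseRange_toLpCLM (by simp)

theorem inner_ket (φ ψ : ModeSchwartz n) :
    ⟪ket φ, ket ψ⟫_ℂ = ∫ x, starRingEnd ℂ (φ x) * ψ x :=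
  (SchwartzMap.inner_toL2_toL2_eq φ ψ MeasureTheory.volume).trans (by simp [mul_comm])

theorem ket_add (φ ψ : ModeSchwartz n) : ket (φ + ψ) = ket φ + ket ψ := map_add _ _ _

theorem ket_smul (c : ℂ) (φ : ModeSchwartz n) : ket (c • φ) = c • ket φ := map_smul _ _ _

/-- `A'` is a formal adjoint of `A` on the Schwartz space. -/
def IsFormalAdjoint (A A' : ModeSchwartz n →ₗ[ℂ] ModeSchwartz n) : Prop :=
  ∀ φ ψ : ModeSchwartz n, ⟪ket (A φ), ket ψ⟫_ℂ = ⟪ket φ, ket (A' ψ)⟫_ℂ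

namespace IsFormalAdjoint

variable {A A' C C' : ModeSchwartz n →ₗ[ℂ] ModeSchwartz n}

theorem zero : IsFormalAdjoint (0 : ModeSchwartz n →ₗ[ℂ] ModeSchwartz n) 0 := fun φ ψ => by
  simp [inner_ket]

theorem add (hA : IsFormalAdjoint A A') (hC : IsFormalAdjoint C C') :
    IsFormalAdjoint (A + C) (A' + C') := fun φ ψ => by
  simp only [LinearMap.add_apply, ket_add, inner_add_left, inner_add_right, hA φ ψ, hC φ ψ]

theorem smul (hA : IsFormalAdjoint A A') (c : ℂ) :
    IsFormalAdjoint (c • A) (starRingEnd ℂ c • A') := fun φ ψ => by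
  simp only [LinearMap.smul_apply, ket_smul, inner_smul_left, inner_smul_right, hA φ ψ]

theorem comp (hA : IsFormalAdjoint A A') (hC : IsFormalAdjoint C C') :
    IsFormalAdjoint (A ∘ₗ C) (C' ∘ₗ A') := fun φ ψ => by
  simp only [LinearMap.comp_apply, hA _ ψ, hC φ _]

theorem sum {ι : Type*} {s : Finset ι} {A A' : ι → ModeSchwartz n →ₗ[ℂ] ModeSchwartz n}
    (h : ∀ i, IsFormalAdjoint (A i) (A' i)) :
    IsFormalAdjoint (∑ i ∈ s, A i) (∑ i ∈ s, A' i) := by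
  classical
  induction s using Finset.induction_on with
  | empty => exact zero
  | insert i s hi ih => simpa only [Finset.sum_insert hi] using (h i).add ih

end IsFormalAdjoint

theorem isFormalAdjoint_positionOp (j : Fin n) :
    IsFormalAdjoint (positionOp j) (positionOp j) := fun φ ψ => by
  simp only [inner_ket, positionOp_apply, map_mul, Complex.conj_ofReal]
  congr 1 with x
  ring

/-- The sign from integration by parts cancels the one from conjugating `-iħ`. -/
theorem isFormalAdjoint_momentumOp (ħ : ℝ) (j : Fin n) :
    IsFormalAdjoint (momentumOp ħ j) (momentumOp ħ j) := fun φ ψ => by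
  have h := SchwartzMap.integral_bilinear_lineDerivOp_right_eq_neg_left
    (μ := MeasureTheory.volume) φ ψ
    ((ContinuousLinearMap.mul ℝ ℂ).comp (Complex.conjCLE : ℂ →L[ℝ] ℂ))
    (EuclideanSpace.single j (1 : ℝ))
  simp only [ContinuousLinearMap.comp_apply, ContinuousLinearMap.mul_apply',
    ContinuousLinearEquiv.coe_coe, Complex.conjCLE_apply] at h
  simp only [momentumOp, LinearMap.smul_apply, ket_smul, inner_smul_left, inner_smul_right,
    inner_ket, ContinuousLinearMap.coe_coe, LineDeriv.lineDerivOpCLM_apply]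
  rw [h]
  simp

theorem isFormalAdjoint_canonicalOp (ħ : ℝ) (j : Fin n ⊕ Fin n) :
    IsFormalAdjoint (canonicalOp ħ j) (canonicalOp ħ j) := by
  cases j with
  | inl j => exact isFormalAdjoint_positionOp j
  | inr j => exact isFormalAdjoint_momentumOp ħ j

theorem isFormalAdjoint_quadHamiltonian (ħ : ℝ) {B : Matrix (Fin n ⊕ Fin n) (Fin n ⊕ Fin n) ℝ}
    (hB : B.IsSymm) (ξ : Fin n ⊕ Fin n → ℝ) :
    IsFormalAdjoint (quadHamiltonian ħ B ξ) (quadHamiltonian ħ B ξ) := by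
  have hx := isFormalAdjoint_canonicalOp (n := n) ħ
  have h := (((IsFormalAdjoint.sum (s := Finset.univ) fun j =>
    IsFormalAdjoint.sum (s := Finset.univ) fun k => ((hx j).comp (hx k)).smul (B j k : ℂ)).smul
      (1 / 2 : ℂ)).add (IsFormalAdjoint.sum (s := Finset.univ) fun j =>
        (hx j).smul ((sympJ n ℝ).mulVec ξ j : ℂ)))
  have h2 : starRingEnd ℂ (1 / 2) = 1 / 2 := by rw [map_div₀, map_one, map_ofNat]
  simp only [Complex.conj_ofReal, h2] at h
  -- Taking adjoints reverses each product `x̂_j x̂_k`; exchanging the indices and using the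
  -- symmetry of `B` restores the original sum.
  rw [Finset.sum_comm (f := fun j k => (B j k : ℂ) • canonicalOp ħ k ∘ₗ canonicalOp ħ j)] at h
  simp only [hB.apply] at h
  exact h

theorem isFormalAdjoint_lindbladOp (ħ : ℝ) (l : Fin n ⊕ Fin n → ℂ) :
    IsFormalAdjoint (lindbladOp ħ l) (lindbladOpAdj ħ l) := by
  have h := IsFormalAdjoint.sum (s := Finset.univ) fun j =>
    (isFormalAdjoint_canonicalOp (n := n) ħ j).smul (Matrix.vecMul l (sympJ n ℂ) j)
  have hJ : ∀ j, starRingEnd ℂ (Matrix.vecMul l (sympJ n ℂ) j) =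
      Matrix.vecMul (star l) (sympJ n ℂ) j := fun j => by
    have hreal : ∀ i, starRingEnd ℂ (sympJ n ℂ i j) = sympJ n ℂ i j := fun i => by
      cases i <;> cases j <;>
        simp [sympJ, Matrix.one_apply, apply_ite]
    simp [Matrix.vecMul, dotProduct, hreal]
  simp only [hJ] at h
  exact h

/-- The Lindblad expression is traceless. -/
theorem traceCLM_lindbladKetBra {K : ℕ} (ħ : ℝ) {Ham : ModeSchwartz n →ₗ[ℂ] ModeSchwartz n}
    {L L' : Fin K → (ModeSchwartz n →ₗ[ℂ] ModeSchwartz n)} (hHam : IsFormalAdjoint Ham Ham)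
    (hL : ∀ k, IsFormalAdjoint (L k) (L' k)) (φ ψ : ModeSchwartz n) :
    TraceClass.traceCLM (ModeSpace n) (lindbladKetBra ħ Ham L L' φ ψ) = 0 := by
  -- All three dissipator terms have trace `⟨L_k ψ, L_k φ⟩`, and their coefficients `2 - 1 - 1`
  -- cancel.
  have hL' : ∀ k, ⟪ket (L' k (L k ψ)), ket φ⟫_ℂ = ⟪ket (L k ψ), ket (L k φ)⟫_ℂ := fun k => by
    rw [← inner_conj_symm, ← hL k, inner_conj_symm]
  simp only [lindbladKetBra, map_add, map_sub, map_smul, map_sum, TraceClass.traceCLM_ketBra,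
    hHam ψ φ, hL', ← hL _ ψ]
  simp [two_mul]

variable {K : ℕ} {ħ : ℝ} {B' : Matrix (Fin n ⊕ Fin n) (Fin n ⊕ Fin n) ℝ}
  {ξ' : Fin n ⊕ Fin n → ℝ} {l : Fin K → Fin n ⊕ Fin n → ℂ}
  {Λ : ℝ → TraceClass (ModeSpace n) →L[ℂ] TraceClass (ModeSpace n)}
  {Λbar : ℝ → (ModeSpace n →L[ℂ] ModeSpace n) →L[ℂ] (ModeSpace n →L[ℂ] ModeSpace n)}

/-- A Gaussian dynamical semigroup preserves the trace of the rank-one operators. -/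
theorem IsGDS.traceCLM_ketBra (hΛ : IsGDS ħ B' ξ' l Λ) (hB' : B'.IsSymm) {t : ℝ} (ht : 0 ≤ t)
    (a b : ModeSpace n) :
    TraceClass.traceCLM _ (Λ t (TraceClass.ketBra a b)) =
      TraceClass.traceCLM _ (TraceClass.ketBra a b) := by
  have hF : ∀ p ∈ gaussianLindbladGraph ħ B' ξ' l,
      TraceClass.traceCLM (ModeSpace n) p.2 = 0 := fun p hp => by
    have hle : gaussianLindbladGraph ħ B' ξ' l ≤ LinearMap.ker
        ((TraceClass.traceCLM (ModeSpace n)).toLinearMap ∘ₗ LinearMap.snd ℂ _ _) := by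
      refine Submodule.span_le.2 ?_
      rintro _ ⟨⟨φ, ψ⟩, rfl⟩
      exact traceCLM_lindbladKetBra ħ (isFormalAdjoint_quadHamiltonian ħ hB' ξ')
        (fun k => isFormalAdjoint_lindbladOp ħ (l k)) φ ψ
    exact hle hp
  have hl := TraceClass.continuous_ketBra_left (H := ModeSpace n)
  have hr := TraceClass.continuous_ketBra_right (H := ModeSpace n)
  refine denseRange_ket.induction_on (p := fun a => TraceClass.traceCLM _
    (Λ t (TraceClass.ketBra a b)) = TraceClass.traceCLM _ (TraceClass.ketBra a b)) a
    (isClosed_eq (by fun_prop) (by fun_prop)) fun φ => ?_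
  refine denseRange_ket.induction_on (p := fun b => TraceClass.traceCLM _
    (Λ t (TraceClass.ketBra (ket φ) b)) = TraceClass.traceCLM _ (TraceClass.ketBra (ket φ) b)) b
    (isClosed_eq (by fun_prop) (by fun_prop)) fun ψ => ?_
  exact hΛ.functional_apply_eq _ hF (Submodule.subset_span ⟨(φ, ψ), rfl⟩) ht

/-- The Heisenberg picture of a Gaussian dynamical semigroup is unital. -/
theorem IsGDS.heisenbergPicture_one (hΛ : IsGDS ħ B' ξ' l Λ) (hB' : B'.IsSymm)
    (hΛbar : IsHeisenbergPicture Λ Λbar) {t : ℝ} (ht : 0 ≤ t) : Λbar t 1 = 1 := by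
  refine eq_of_opTrace_mul_rankOne fun φ ψ => ?_
  -- The order of `ψ` and `φ` is reversed because the pairing takes the adjoint of its first
  -- argument.
  have h := hΛbar t ht (TraceClass.ketBra ψ φ) 1
  have htr := hΛ.traceCLM_ketBra hB' ht ψ φ
  rw [TraceClass.traceCLM_apply, TraceClass.traceCLM_apply] at htr
  rw [hsInner, hsInner, mul_one, opTrace_star, htr, ← opTrace_star, TraceClass.toOp_ketBra,
    ContinuousLinearMap.star_eq_adjoint, InnerProductSpace.adjoint_rankOne] at h
  rw [one_mul, ← (isNuclearRep_rankOne φ ψ).opTrace_mul_comm, ← h]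

/-- Gibbs states are self-adjoint. -/
theorem IsGibbs.star_eq_self {β : ℝ} {B : Matrix (Fin n ⊕ Fin n) (Fin n ⊕ Fin n) ℝ}
    {σ : TraceClass (ModeSpace n)} (hσ : IsGibbs ħ β B σ) (hB : B.IsSymm) (hβ : 0 ≤ β) :
    star σ.toOp = σ.toOp := by
  obtain ⟨S, hS, hσS⟩ := hσ
  have hmem : ∀ p, p ∈ negGraph (quadHamiltonian ħ B 0) ↔
      ∃ φ : ModeSchwartz n, (ket φ, -ket (quadHamiltonian ħ B 0 φ)) = p := fun p => by
    -- The spanning set is the range of a linear map, hence already a subspace: every element of the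
    -- graph comes from a single `φ`.
    let T : ModeSchwartz n →ₗ[ℂ] ModeSpace n × ModeSpace n :=
      LinearMap.prod (SchwartzMap.toLpCLM ℂ ℂ 2 MeasureTheory.volume).toLinearMap
        (-((SchwartzMap.toLpCLM ℂ ℂ 2 MeasureTheory.volume).toLinearMap ∘ₗ
          quadHamiltonian ħ B 0))
    have hT : negGraph (quadHamiltonian ħ B 0) = LinearMap.range T :=
      Submodule.span_eq (LinearMap.range T)
    rw [hT]
    exact LinearMap.mem_range
  rw [hσS]
  refine hS.star_eq_self (fun p hp q hq => ?_) (denseRange_ket.mono ?_) hβ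
  · obtain ⟨φ, rfl⟩ := (hmem p).1 hp
    obtain ⟨ψ, rfl⟩ := (hmem q).1 hq
    simp only [inner_neg_left, inner_neg_right, isFormalAdjoint_quadHamiltonian ħ hB 0 φ ψ]
  · rintro _ ⟨φ, rfl⟩
    exact ⟨_, (hmem _).2 ⟨φ, rfl⟩⟩

end Modes

/-! ### Invariance of the Gibbs state -/

theorem theorem2 {n K : ℕ} (ħ β : ℝ) (hħ : 0 < ħ) (hβ : 0 < β)
    (B' : Matrix (Fin n ⊕ Fin n) (Fin n ⊕ Fin n) ℝ) (hB' : B'.IsSymm)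
    (ξ' : Fin n ⊕ Fin n → ℝ) (l : Fin K → Fin n ⊕ Fin n → ℂ)
    (B : Matrix (Fin n ⊕ Fin n) (Fin n ⊕ Fin n) ℝ) (hB : B.IsSymm)
    (Λ : ℝ → TraceClass (ModeSpace n) →L[ℂ] TraceClass (ModeSpace n))
    (Λbar : ℝ → (ModeSpace n →L[ℂ] ModeSpace n) →L[ℂ] (ModeSpace n →L[ℂ] ModeSpace n))
    (σ : TraceClass (ModeSpace n))
    (hΛ : IsGDS ħ B' ξ' l Λ) (hΛbar : IsHeisenbergPicture Λ Λbar)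
    (hσ : IsGibbs ħ β B σ) (hDB : DetailedBalance σ Λbar) :
    (∀ t : ℝ, 0 ≤ t → Λ t σ = σ) ∧ HasGenerator Λ σ 0 := by
  have hinv : ∀ t : ℝ, 0 ≤ t → Λ t σ = σ := fun t ht => by
    have hsa := hσ.star_eq_self hB hβ.le
    -- The pairing contains `Λ_t[σ]†`, so the adjoints are compared.
    refine TraceClass.toOp_injective (star_injective (eq_of_opTrace_mul_rankOne fun φ ψ => ?_))
    have h1 := hΛbar t ht σ (InnerProductSpace.rankOne ℂ φ ψ)
    have h2 := hDB t ht 1 (InnerProductSpace.rankOne ℂ φ ψ)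
    rw [hΛ.heisenbergPicture_one hB' hΛbar ht] at h2
    simp only [gnsInner, hsInner, star_one, one_mul, hsa] at h1 h2
    rw [h1, ← h2, hsa]
  -- The orbit of `σ` is constant, so every difference quotient with `t > 0` is `0`.
  refine ⟨hinv, tendsto_const_nhds.congr' ?_⟩
  filter_upwards [self_mem_nhdsWithin] with t ht
  rw [hinv t (le_of_lt ht), sub_self, smul_zero]
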